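/- Let $\mathcal X,\mathcal Y$ be finite nonempty alphabets and $P_{Y|X}$ a channel from $\mathcal X$ to $\mathcal Y$. For an integer $M\ge 1$ put $\mathcal S=\widehat{\mathcal S}=\{1,\dots,M\}$, $P_S(s)=1/M$ and $\kappa(s,x,y,\widehat s)=\mathbb I\{s\ne\widehat s\}$. A (randomized) code is a pair of conditional distributions $(Q_{X|S},Q_{\widehat S|Y})$; its error probability is $$\mathbb E[\mathbb I\{S\ne\widehat S\}]=\sum_{s,x,y,\widehat s}\kappa(s,x,y,\widehat s)\,P_S(s)Q_{X|S}(x|s)P_{Y|X}(y|x)Q_{\widehat S|Y}(\widehat s|y).$$ A deterministic code is a pair of maps $f:\mathcal S\to\mathcal X$, $g:\mathcal Y\to\widehat{\mathcal S}$, identified with the code $Q_{X|S}(x|s)=\mathbb I\{x=f(s)\}$, $Q_{\widehat S|Y}(\widehat s|y)=\mathbb I\{\widehat s=g(y)\}$. Let $\mathrm{OPT}(\mathrm{SC})$ be the infimum of the error probability over all randomized codes. Consider the following programs. * $\mathrm{LP}'$: minimize $\sum_{s,x,y,\widehat s}\kappa(s,x,y,\widehat s)P_S(s)P_{Y|X}(y|x)W(s,x,y,\widehat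 s)$ over real-valued $Q_{X|S},Q_{\widehat S|Y},W\ge 0$ such that, for all $s,x,y,\widehat s$, $\sum_{x'}Q_{X|S}(x'|s)=1$, $\sum_{s'}Q_{\widehat S|Y}(s'|y)=1$, $\sum_{x'} W(s,x',y,\widehat s)=Q_{\widehat S|Y}(\widehat s|y)$ and $\sum_{s'}W(s,x,y,s')=Q_{X|S}(x|s)$. * $\mathrm{NS}$ (Matthews' non-signaling program): minimize $1-\frac1M\sum_{s,x,y}P_{Y|X}(y|x)W(s,x,y,s)$ over $Q_{X|S},Q_{\widehat S|Y},W\ge0$ such that, for all $s,x,y,\widehat s$, $\sum_{x'} W(s,x',y,\widehat s)=Q_{\widehat S|Y}(\widehat s|y)$, $\sum_{s'}W(s,x,y,s')=Q_{X|S}(x|s)$ and $\sum_{x',s'}W(s,x',y,s')=1$. * $\mathrm{DP}$: maximize $\sum_s\gamma^a(s)+\sum_y\gamma^b(y)-\sum_{s,x,y,\widehat s}\mu(s,x,y,\widehat s)$ over real-valued $\gamma^a(s),\gamma^b(y),\lambda^a(s,\widehat s,y),\lambda^b(x,s,y)$ and $\mu(s,x,y,\widehat s)\ge0$ such that $\gamma^a(s)-\sum_y\lambda^b(x,s,y)-\sum_{\widehat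 s,y}\mu(s,x,y,\widehat s)\le0$ for all $x,s$; $\gamma^b(y)-\sum_s\lambda^a(s,\widehat s,y)-\sum_{x,s}\mu(s,x,y,\widehat s)\le0$ for all $\widehat s,y$; $\lambda^a(s,\widehat s,y)+\lambda^b(x,s,y)+\mu(s,x,y,\widehat s)\le\kappa(s,x,y,\widehat s)P_S(s)P_{Y|X}(y|x)$ for all $s,x,y,\widehat s$. * $\mathrm{DP}'$: the program $\mathrm{DP}$ with $\mu\equiv0$. **Theorem (DP implies the Polyanskiy–Poor–Verdú converse).** (i) For every $M\ge1$, $\mathrm{NS}$ and $\mathrm{LP}'$ have the same feasible region and their objectives agree on it; moreover $$\mathrm{OPT}(\mathrm{NS})=\mathrm{OPT}(\mathrm{LP}')=\mathrm{OPT}(\mathrm{DP}').$$ (ii) For every $M\ge1$ and every code, $$\mathbb E[\mathbb I\{S\ne\widehat S\}]\ \ge\ \mathrm{OPT}(\mathrm{SC})\ \ge\ \mathrm{OPT}(\mathrm{DP})\ \ge\ \mathrm{OPT}(\mathrm{DP}'),$$ and $\mathrm{OPT}(\mathrm{SC})$ is unchanged if only deterministic codes are allowed. (iii) For $0\le\epsilon<1$,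 let $M(\epsilon)$ be the largest $M\ge1$ for which a deterministic code with error probability at most $\epsilon$ exists, let $M^{\mathrm{DP}'}(\epsilon)$ be the largest $M\ge1$ with $\mathrm{OPT}(\mathrm{DP}')\le\epsilon$ (the program $\mathrm{DP}'$ being formed with $M$ messages), and let $$M^{\mathrm{PPV}}(\epsilon)=\sup_{P_X}\ \inf_{Q_Y}\ \frac1{\beta_{1-\epsilon}(P_{XY},P_X\times Q_Y)},\qquad P_{XY}(x,y)=P_{Y|X}(y|x)P_X(x),$$ over probability distributions $P_X$ on $\mathcal X$ and $Q_Y$ on $\mathcal Y$, with $1/0=\infty$, where $\beta_{1-\epsilon}(P,Q)$ is the minimum of $\sum_rT(r)Q(r)$ over $T$ with values in $[0,1]$ and $\sum_rT(r)P(r)\ge1-\epsilon$. Then both maxima exist, $M^{\mathrm{PPV}}(\epsilon)<\infty$, and $$M(\epsilon)\ \le\ M^{\mathrm{DP}'}(\epsilon)\ =\ \lfloor M^{\mathrm{PPV}}(\epsilon)\rfloor .$$ -/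

import Mathlib

open scoped ENNReal

noncomputable section

namespace SourceChannel

/-- Conditional probability distributions `Q(b|a)`, written `Q a b`. -/
def condDist (A B : Type*) [Fintype B] : Set (A → B → ℝ) :=
  {Q | ∀ a, Q a ∈ stdSimplex ℝ B}

section General

variable {S X Y S' : Type*} [Fintype S] [Fintype X] [Fintype Y] [Fintype S']

/-- The joint distribution `P_S(s) Q_{X|S}(x|s) P_{Y|X}(y|x) Q_{S'|Y}(s'|y)`. -/
def jointDist (PS : S → ℝ) (P : X → Y → ℝ) (QX : S → X → ℝ) (QS : Y → S' → ℝ) :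
    S → X → Y → S' → ℝ :=
  fun s x y s' => PS s * QX s x * P x y * QS y s'

/-- Expected loss of the randomized code with encoder `QX` and decoder `QS`. -/
def expectedLoss (PS : S → ℝ) (P : X → Y → ℝ) (κ : S → X → Y → S' → ℝ)
    (QX : S → X → ℝ) (QS : Y → S' → ℝ) : ℝ :=
  ∑ s, ∑ x, ∑ y, ∑ s', κ s x y s' * jointDist PS P QX QS s x y s'

/-- Expected loss of the deterministic code `(f, g)`. -/
def codeLoss (PS : S → ℝ) (P : X → Y → ℝ) (κ : S → X → Y → S' → ℝ)
    (f : S → X) (g : Y → S') : ℝ :=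
  ∑ s, ∑ y, κ s (f s) y (g y) * (PS s * P (f s) y)

/-- Optimal value of SC over deterministic codes. -/
def optSCDet (PS : S → ℝ) (P : X → Y → ℝ) (κ : S → X → Y → S' → ℝ) : EReal :=
  ⨅ (f : S → X) (g : Y → S'), (codeLoss PS P κ f g : EReal)

/-- Optimal value of SC in its continuous formulation, over randomized codes. -/
def optSC (PS : S → ℝ) (P : X → Y → ℝ) (κ : S → X → Y → S' → ℝ) : EReal :=
  ⨅ (QX ∈ condDist S X) (QS ∈ condDist Y S'), (expectedLoss PS P κ QX QS : EReal)

/-- The variables `(Q_{X|S}, Q_{S'|Y}, W)` of the linear relaxations. -/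
structure PrimalPoint (S X Y S' : Type*) where
  QX : S → X → ℝ
  QS : Y → S' → ℝ
  W : S → X → Y → S' → ℝ

/-- Feasible region of LP'. -/
def feaLP' (S X Y S' : Type*) [Fintype X] [Fintype S'] : Set (PrimalPoint S X Y S') :=
  {v | (∀ s, ∑ x, v.QX s x = 1) ∧
    (∀ y, ∑ s', v.QS y s' = 1) ∧
    (∀ s s' y, ∑ x, v.W s x y s' - v.QS y s' = 0) ∧
    (∀ x s y, ∑ s', v.W s x y s' - v.QX s x = 0) ∧
    (∀ s x, 0 ≤ v.QX s x) ∧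
    (∀ s' y, 0 ≤ v.QS y s') ∧
    (∀ s x y s', 0 ≤ v.W s x y s')}

/-- Objective function of LP'. -/
def objLP' (PS : S → ℝ) (P : X → Y → ℝ) (κ : S → X → Y → S' → ℝ)
    (v : PrimalPoint S X Y S') : ℝ :=
  ∑ s, ∑ x, ∑ y, ∑ s', κ s x y s' * PS s * P x y * v.W s x y s'

/-- Optimal value of LP'. -/
def optLP' (PS : S → ℝ) (P : X → Y → ℝ) (κ : S → X → Y → S' → ℝ) : EReal :=
  ⨅ v ∈ feaLP' S X Y S', (objLP' PS P κ v : EReal)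

/-- The dual variables `γᵃ(s), γᵇ(y), λᵃ(s,s',y), λᵇ(x,s,y), μ(s,x,y,s')`. -/
structure DualPoint (S X Y S' : Type*) where
  γa : S → ℝ
  γb : Y → ℝ
  la : S → S' → Y → ℝ
  lb : X → S → Y → ℝ
  μ : S → X → Y → S' → ℝ

/-- Feasible region of DP. -/
def feaDP (PS : S → ℝ) (P : X → Y → ℝ) (κ : S → X → Y → S' → ℝ) :
    Set (DualPoint S X Y S') :=
  {v | (∀ x s, v.γa s - ∑ y, v.lb x s y - ∑ s', ∑ y, v.μ s x y s' ≤ 0) ∧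
    (∀ s' y, v.γb y - ∑ s, v.la s s' y - ∑ x, ∑ s, v.μ s x y s' ≤ 0) ∧
    (∀ s x y s', v.la s s' y + v.lb x s y + v.μ s x y s' ≤ κ s x y s' * PS s * P x y) ∧
    (∀ s x y s', 0 ≤ v.μ s x y s')}

/-- Objective function of DP. -/
def objDP (v : DualPoint S X Y S') : ℝ :=
  ∑ s, v.γa s + ∑ y, v.γb y - ∑ s, ∑ x, ∑ y, ∑ s', v.μ s x y s'

/-- Optimal value of DP. -/
def optDP (PS : S → ℝ) (P : X → Y → ℝ) (κ : S → X → Y → S' → ℝ) : EReal :=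
  ⨆ v ∈ feaDP PS P κ, (objDP v : EReal)

/-- Feasible region of DP': that of DP with `μ` identically zero. -/
def feaDP' (PS : S → ℝ) (P : X → Y → ℝ) (κ : S → X → Y → S' → ℝ) :
    Set (DualPoint S X Y S') :=
  {v | v ∈ feaDP PS P κ ∧ ∀ s x y s', v.μ s x y s' = 0}

/-- Optimal value of DP'. -/
def optDP' (PS : S → ℝ) (P : X → Y → ℝ) (κ : S → X → Y → S' → ℝ) : EReal :=
  ⨆ v ∈ feaDP' PS P κ, (objDP v : EReal)

end General

section ChannelCoding

variable {X Y : Type*} [Fintype X] [Fintype Y]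

/-- The uniform distribution on `M` messages. -/
def unif (M : ℕ) : Fin M → ℝ := fun _ => 1 / (M : ℝ)

/-- The loss `𝕀{s ≠ s'}`. -/
def errLoss (X Y : Type*) (M : ℕ) : Fin M → X → Y → Fin M → ℝ :=
  fun s _ _ s' => if s ≠ s' then 1 else 0

/-- Feasible region of the non-signaling program NS with `M` messages. -/
def feaNS (X Y : Type*) [Fintype X] (M : ℕ) : Set (PrimalPoint (Fin M) X Y (Fin M)) :=
  {v | (∀ s s' y, ∑ x, v.W s x y s' - v.QS y s' = 0) ∧
    (∀ x s y, ∑ s', v.W s x y s' - v.QX s x = 0) ∧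
    (∀ s y, ∑ x, ∑ s', v.W s x y s' = 1) ∧
    (∀ s x, 0 ≤ v.QX s x) ∧
    (∀ s' y, 0 ≤ v.QS y s') ∧
    (∀ s x y s', 0 ≤ v.W s x y s')}

/-- Objective function of NS. -/
def objNS (P : X → Y → ℝ) (M : ℕ) (v : PrimalPoint (Fin M) X Y (Fin M)) : ℝ :=
  1 - 1 / (M : ℝ) * ∑ s, ∑ x, ∑ y, P x y * v.W s x y s

/-- Optimal value of NS. -/
def optNS (P : X → Y → ℝ) (M : ℕ) : EReal :=
  ⨅ v ∈ feaNS X Y M, (objNS P M v : EReal)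

/-- The sizes `M ≥ 1` for which some deterministic code has error probability at most `ε`. -/
def achievableSizes (P : X → Y → ℝ) (ε : ℝ) : Set ℕ :=
  {M | 1 ≤ M ∧ ∃ (f : Fin M → X) (g : Y → Fin M), codeLoss (unif M) P (errLoss X Y M) f g ≤ ε}

/-- `M(ε)`, the largest size of a code with error probability at most `ε`. -/
def maxCodeSize (P : X → Y → ℝ) (ε : ℝ) : ℕ :=
  sSup (achievableSizes P ε)

/-- The sizes `M ≥ 1` not excluded by `OPT(DP') ≤ ε`. -/
def sizesDP' (P : X → Y → ℝ) (ε : ℝ) : Set ℕ :=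
  {M | 1 ≤ M ∧ optDP' (unif M) P (errLoss X Y M) ≤ (ε : EReal)}

/-- `M^{DP'}(ε)`, the largest size not excluded by `OPT(DP') ≤ ε`. -/
def maxSizeDP' (P : X → Y → ℝ) (ε : ℝ) : ℕ :=
  sSup (sizesDP' P ε)

/-- Randomized tests `T` of `P` (null hypothesis) with type I error at most `1 - α`. -/
def tests {R : Type*} [Fintype R] (α : ℝ) (P : R → ℝ) : Set (R → ℝ) :=
  {T | (∀ r, 0 ≤ T r ∧ T r ≤ 1) ∧ α ≤ ∑ r, T r * P r}

/-- `β_α(P, Q)`, the least type II error of such a test. -/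
def beta {R : Type*} [Fintype R] (α : ℝ) (P Q : R → ℝ) : ℝ≥0∞ :=
  ⨅ T ∈ tests α P, ENNReal.ofReal (∑ r, T r * Q r)

/-- The bound `M^{PPV}(ε) = sup_{P_X} inf_{Q_Y} 1 / β_{1-ε}(P_{XY}, P_X × Q_Y)`,
with `1 / 0 = ∞`. -/
def boundPPV (P : X → Y → ℝ) (ε : ℝ) : ℝ≥0∞ :=
  ⨆ PX ∈ stdSimplex ℝ X, ⨅ QY ∈ stdSimplex ℝ Y,
    (beta (1 - ε) (fun r : X × Y => P r.1 r.2 * PX r.1) (fun r : X × Y => PX r.1 * QY r.2))⁻¹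

end ChannelCoding

end SourceChannel

end

/-!
Every randomized code is a point of the linear relaxation LP' with `W = QX * QS`, so weak duality
bounds its loss from below; the multiplier `μ` of DP is admissible for such points because
`(1 - QX) * (1 - QS) ≥ 0`. Deterministic codes suffice since the expected loss is affine in each
kernel. Strong duality between LP' and DP' comes from a Lagrange multiplier for the coupling
constraints over the compact convex set of triples of kernels: minimizing the Lagrangian at
deterministic points produces a feasible point of DP'.

For channel coding, averaging a point of LP' over the `M` messages turns it into a pair `(P_X, R)`,
where `R = P_X * T` for a test `T` of power `1 - ε` and `∑ x, R x y = 1 / M` for every `y`;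
conversely, sharing the remaining weight `P_X - R` equally among the wrong messages recovers a
point of LP'. The payoff `∑ y, Q_Y(y) ∑ x, R x y` is bilinear in `(P_X, R)` and `Q_Y`, so the
game with this payoff has a saddle point, with value `t`. Then `M^PPV = 1 / t`, and since every
`R ≤ P_X` can be enlarged to prescribed output masses up to `1`, the message sizes allowed by LP'
are exactly those with `1 / M ≥ t`.
-/

noncomputable section

namespace SourceChannel

section Minimax

variable {E : Type*} [AddCommGroup E] [Module ℝ E] [TopologicalSpace E]
  [IsTopologicalAddGroup E] [ContinuousSMul ℝ E]

theorem exists_lagrange_multiplier {ι : Type*} [Fintype ι] {K : Set E} (hK : IsCompact K)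
    (hconv : Convex ℝ K) (c : E →L[ℝ] ℝ) (A : E →L[ℝ] ι → ℝ) {r : ℝ}
    (h : ∀ v ∈ K, A v = 0 → r < c v) :
    ∃ l : ι → ℝ, ∀ v ∈ K, r < c v + l ⬝ᵥ A v := by
  rcases K.eq_empty_or_nonempty with rfl | hne
  · exact ⟨0, by simp⟩
  have hpointwise : ∀ v ∈ K, ∃ l : ι → ℝ, r < c v + l ⬝ᵥ A v := by
    intro v hv
    by_cases hAv : A v = 0
    · exact ⟨0, by simpa using h v hv hAv⟩
    · have hpos : 0 < A v ⬝ᵥ A v := by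
        simpa using Matrix.dotProduct_self_star_pos_iff.2 hAv
      refine ⟨((r - c v + 1) / (A v ⬝ᵥ A v)) • A v, ?_⟩
      rw [smul_dotProduct, smul_eq_mul, div_mul_cancel₀ _ hpos.ne']
      linarith
  choose! m hm using hpointwise
  obtain ⟨t, -, ht⟩ := hK.elim_nhdsWithin_subcover
    (fun v => {w | r < c w + m v ⬝ᵥ A w}) fun v hv => mem_nhdsWithin_of_mem_nhds <|
      (isOpen_lt (by fun_prop) (by unfold dotProduct; fun_prop)).mem_nhds (hm v hv)
  have hcover : ∀ w ∈ K, ∃ l ∈ m '' t, r < c w + l ⬝ᵥ A w := fun w hw => by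
    simpa using ht hw
  obtain ⟨l, -, hl⟩ := Sion.exists_lt_iInf_of_lt_iInf_of_finite hne hK
    (f := fun v (l : ι → ℝ) => c v + l ⬝ᵥ A v) (Y := Set.univ)
    (fun l _ => ContinuousOn.lowerSemicontinuousOn (by unfold dotProduct; fun_prop))
    (fun l _ => ConvexOn.quasiconvexOn ⟨hconv, fun v _ w _ a b _ _ _ => by
      simp only [map_add, map_smul, dotProduct_add, dotProduct_smul, smul_eq_mul]
      exact le_of_eq (by ring)⟩)
    convex_univ
    (fun v _ => ContinuousOn.upperSemicontinuousOn (by unfold dotProduct; fun_prop))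
    (fun v _ => ConcaveOn.quasiconcaveOn ⟨convex_univ, fun l _ k _ a b _ _ hab => by
      simp only [add_dotProduct, smul_dotProduct, smul_eq_mul]
      exact le_of_eq (by linear_combination (c v) * hab)⟩)
    hconv (t.finite_toSet.image m) (Set.subset_univ _) hcover
  exact ⟨l, hl⟩

end Minimax

section Simplex

theorem le_sum_mul_of_mem_stdSimplex {R A : Type*} [Semiring R] [PartialOrder R] [IsOrderedRing R]
    [Fintype A] {q c : A → R} (hq : q ∈ stdSimplex R A) {m : R} (h : ∀ a, m ≤ c a) :
    m ≤ ∑ a, q a * c a :=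
  calc m = ∑ a, q a * m := by rw [← Finset.sum_mul, hq.2, one_mul]
    _ ≤ ∑ a, q a * c a := Finset.sum_le_sum fun a _ => mul_le_mul_of_nonneg_left (h a) (hq.1 a)

theorem sum_mul_le_of_mem_stdSimplex {R A : Type*} [Semiring R] [PartialOrder R] [IsOrderedRing R]
    [Fintype A] {q c : A → R} (hq : q ∈ stdSimplex R A) {m : R} (h : ∀ a, c a ≤ m) :
    ∑ a, q a * c a ≤ m :=
  calc ∑ a, q a * c a ≤ ∑ a, q a * m :=
        Finset.sum_le_sum fun a _ => mul_le_mul_of_nonneg_left (h a) (hq.1 a)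
    _ = m := by rw [← Finset.sum_mul, hq.2, one_mul]

theorem exists_le_sum_mul_of_mem_stdSimplex {R A : Type*} [Ring R] [LinearOrder R]
    [IsStrictOrderedRing R] [Fintype A] {q : A → R} (hq : q ∈ stdSimplex R A) (c : A → R) :
    ∃ a, c a ≤ ∑ b, q b * c b := by
  have : Nonempty A := by
    by_contra hA
    rw [not_nonempty_iff] at hA
    simpa using hq.2
  obtain ⟨a, ha⟩ := Finite.exists_min c
  exact ⟨a, le_sum_mul_of_mem_stdSimplex hq ha⟩

variable {A B : Type*} [Fintype B]

theorem condDist_eq_pi : condDist A B = Set.univ.pi fun _ => stdSimplex ℝ B := by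
  ext Q
  simp [condDist]

theorem nonempty_of_mem_condDist [Nonempty A] {Q : A → B → ℝ}
    (hQ : Q ∈ condDist A B) : Nonempty B := by
  by_contra hB
  rw [not_nonempty_iff] at hB
  simpa using (hQ (Classical.arbitrary A)).2

theorem convex_condDist : Convex ℝ (condDist A B) := by
  rw [condDist_eq_pi]
  exact convex_pi fun _ _ => convex_stdSimplex ℝ B

theorem isCompact_condDist : IsCompact (condDist A B) := by
  rw [condDist_eq_pi]
  exact isCompact_univ_pi fun _ => isCompact_stdSimplex ℝ B

theorem single_mem_condDist [DecidableEq B] (f : A → B) :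
    (fun a => Pi.single (f a) 1) ∈ condDist A B :=
  fun a => single_mem_stdSimplex ℝ (f a)

end Simplex

section SumExchange

theorem sum_sum_comm {A B C D R : Type*} [Fintype A] [Fintype B] [Fintype C] [Fintype D]
    [AddCommMonoid R] (F : A → B → C → D → R) :
    ∑ c, ∑ d, ∑ a, ∑ b, F a b c d = ∑ a, ∑ b, ∑ c, ∑ d, F a b c d := by
  rw [Finset.sum_comm_cycle]
  exact Finset.sum_congr rfl fun a _ => Finset.sum_comm_cycle

end SumExchange

section Codes

variable {S X Y S' : Type*} [Fintype X] [Fintype S']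

theorem mem_feaLP'_iff {v : PrimalPoint S X Y S'} :
    v ∈ feaLP' S X Y S' ↔ v.QX ∈ condDist S X ∧ v.QS ∈ condDist Y S' ∧
      (∀ s y s', ∑ x, v.W s x y s' = v.QS y s') ∧
      (∀ s x y, ∑ s', v.W s x y s' = v.QX s x) ∧ ∀ s x y s', 0 ≤ v.W s x y s' := by
  simp only [feaLP', Set.mem_ofPred_eq, sub_eq_zero]
  exact ⟨fun ⟨hQX, hQS, hWS, hWX, hQX0, hQS0, hW⟩ => ⟨fun s => ⟨hQX0 s, hQX s⟩,
      fun y => ⟨fun s' => hQS0 s' y, hQS y⟩, fun s y s' => hWS s s' y, fun s x y => hWX x s y, hW⟩,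
    fun ⟨hQX, hQS, hWS, hWX, hW⟩ => ⟨fun s => (hQX s).2, fun y => (hQS y).2,
      fun s s' y => hWS s y s', fun x s y => hWX s x y, fun s => (hQX s).1,
      fun s' y => (hQS y).1 s', hW⟩⟩

/-- The relaxation point of the randomized code `(QX, QS)`, where `W` is the product `QX * QS`. -/
def productPoint (QX : S → X → ℝ) (QS : Y → S' → ℝ) : PrimalPoint S X Y S' :=
  ⟨QX, QS, fun s x y s' => QX s x * QS y s'⟩

theorem productPoint_mem_feaLP' {QX : S → X → ℝ} (hQX : QX ∈ condDist S X) {QS : Y → S' → ℝ}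
    (hQS : QS ∈ condDist Y S') : productPoint QX QS ∈ feaLP' S X Y S' :=
  mem_feaLP'_iff.2 ⟨hQX, hQS,
    fun s y s' => by simp [productPoint, ← Finset.sum_mul, (hQX s).2],
    fun s x y => by simp [productPoint, ← Finset.mul_sum, (hQS y).2],
    fun s x y s' => mul_nonneg ((hQX s).1 x) ((hQS y).1 s')⟩

variable [Fintype S] [Fintype Y] {PS : S → ℝ} {P : X → Y → ℝ} {κ : S → X → Y → S' → ℝ}

theorem objLP'_productPoint (QX : S → X → ℝ) (QS : Y → S' → ℝ) :
    objLP' PS P κ (productPoint QX QS) = expectedLoss PS P κ QX QS := by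
  simp only [objLP', productPoint, expectedLoss, jointDist]
  refine Finset.sum_congr rfl fun s _ => Finset.sum_congr rfl fun x _ =>
    Finset.sum_congr rfl fun y _ => Finset.sum_congr rfl fun s' _ => ?_
  ring

theorem expectedLoss_single [DecidableEq X] [DecidableEq S'] (f : S → X) (g : Y → S') :
    expectedLoss PS P κ (fun s => Pi.single (f s) 1) (fun y => Pi.single (g y) 1) =
      codeLoss PS P κ f g := by
  simp [expectedLoss, jointDist, codeLoss, Pi.single_apply]

theorem sum_γa_le {d : DualPoint S X Y S'} (hd : d ∈ feaDP PS P κ) {v : PrimalPoint S X Y S'}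
    (hv : v ∈ feaLP' S X Y S') :
    ∑ s, d.γa s ≤ ∑ s, ∑ x, ∑ y, ∑ s', (v.W s x y s' * d.lb x s y + v.QX s x * d.μ s x y s') := by
  obtain ⟨hQX, -, -, hW, -⟩ := mem_feaLP'_iff.1 hv
  refine Finset.sum_le_sum fun s _ => ?_
  calc d.γa s ≤ ∑ x, v.QX s x * (∑ y, d.lb x s y + ∑ s', ∑ y, d.μ s x y s') :=
        le_sum_mul_of_mem_stdSimplex (hQX s) fun x => by linarith [hd.1 x s]
    _ = _ := Finset.sum_congr rfl fun x _ => by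
        rw [Finset.sum_comm (γ := S')]
        simp only [Finset.sum_add_distrib, ← Finset.sum_mul, ← Finset.mul_sum, hW, mul_add]

theorem sum_γb_le {d : DualPoint S X Y S'} (hd : d ∈ feaDP PS P κ) {v : PrimalPoint S X Y S'}
    (hv : v ∈ feaLP' S X Y S') :
    ∑ y, d.γb y ≤
      ∑ s, ∑ x, ∑ y, ∑ s', (v.W s x y s' * d.la s s' y + v.QS y s' * d.μ s x y s') := by
  obtain ⟨-, hQS, hW, -⟩ := mem_feaLP'_iff.1 hv
  rw [← sum_sum_comm]
  refine Finset.sum_le_sum fun y _ => ?_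
  calc d.γb y ≤ ∑ s', v.QS y s' * (∑ s, d.la s s' y + ∑ x, ∑ s, d.μ s x y s') :=
        le_sum_mul_of_mem_stdSimplex (hQS y) fun s' => by linarith [hd.2.1 s' y]
    _ = _ := Finset.sum_congr rfl fun s' _ => by
        rw [Finset.sum_comm (γ := X)]
        simp only [Finset.sum_add_distrib, ← Finset.sum_mul, ← Finset.mul_sum, hW, mul_add]

/-- Here `μ` is the multiplier of the constraint `QX + QS - 1 ≤ W`, which is not implied in LP' but
holds for the product of `QX` and `QS`. -/
theorem objDP_add_le_objLP' {d : DualPoint S X Y S'} (hd : d ∈ feaDP PS P κ)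
    {v : PrimalPoint S X Y S'} (hv : v ∈ feaLP' S X Y S') :
    objDP d + ∑ s, ∑ x, ∑ y, ∑ s', d.μ s x y s' * (1 - v.QX s x - v.QS y s' + v.W s x y s') ≤
      objLP' PS P κ v := by
  obtain ⟨-, -, -, -, hW⟩ := mem_feaLP'_iff.1 hv
  refine (add_le_add_left (sub_le_sub_right (add_le_add (sum_γa_le hd hv) (sum_γb_le hd hv)) _)
    _).trans ?_
  simp only [objLP', ← Finset.sum_add_distrib, ← Finset.sum_sub_distrib]
  gcongr with s _ x _ y _ s' _
  linear_combination mul_le_mul_of_nonneg_left (hd.2.2.1 s x y s') (hW s x y s')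

theorem optDP'_le_optLP' : optDP' PS P κ ≤ optLP' PS P κ :=
  iSup₂_le fun d hd => le_iInf₂ fun v hv => EReal.coe_le_coe_iff.2 <| by
    simpa [hd.2] using objDP_add_le_objLP' hd.1 hv

theorem optDP'_le_optDP : optDP' PS P κ ≤ optDP PS P κ :=
  biSup_mono fun _ hd => hd.1

theorem optDP_le_optSC : optDP PS P κ ≤ optSC PS P κ := by
  refine iSup₂_le fun d hd => le_iInf₂ fun QX hQX => le_iInf₂ fun QS hQS =>
    EReal.coe_le_coe_iff.2 ?_
  rw [← objLP'_productPoint]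
  refine le_trans (le_add_of_nonneg_right ?_)
    (objDP_add_le_objLP' hd (productPoint_mem_feaLP' hQX hQS))
  refine Finset.sum_nonneg fun s _ => Finset.sum_nonneg fun x _ => Finset.sum_nonneg fun y _ =>
    Finset.sum_nonneg fun s' _ => mul_nonneg (hd.2.2.2 s x y s') ?_
  have hX := (mem_Icc_of_mem_stdSimplex (hQX s) x).2
  have hS := (mem_Icc_of_mem_stdSimplex (hQS y) s').2
  simp only [productPoint]
  linear_combination mul_nonneg (sub_nonneg.2 hX) (sub_nonneg.2 hS)

theorem exists_codeLoss_le_expectedLoss {QX : S → X → ℝ} (hQX : QX ∈ condDist S X)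
    {QS : Y → S' → ℝ} (hQS : QS ∈ condDist Y S') :
    ∃ f g, codeLoss PS P κ f g ≤ expectedLoss PS P κ QX QS := by
  choose g hg using fun y => exists_le_sum_mul_of_mem_stdSimplex (hQS y)
    fun s' => ∑ s, ∑ x, κ s x y s' * (PS s * QX s x * P x y)
  choose f hf using fun s => exists_le_sum_mul_of_mem_stdSimplex (hQX s)
    fun x => ∑ y, κ s x y (g y) * (PS s * P x y)
  refine ⟨f, g, ?_⟩
  calc codeLoss PS P κ f g
      ≤ ∑ s, ∑ x, QX s x * ∑ y, κ s x y (g y) * (PS s * P x y) :=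
        Finset.sum_le_sum fun s _ => hf s
    _ = ∑ y, ∑ s, ∑ x, κ s x y (g y) * (PS s * QX s x * P x y) := by
        rw [← Finset.sum_comm_cycle]
        simp only [Finset.mul_sum]
        refine Finset.sum_congr rfl fun s _ => Finset.sum_congr rfl fun x _ =>
          Finset.sum_congr rfl fun y _ => ?_
        ring
    _ ≤ ∑ y, ∑ s', QS y s' * ∑ s, ∑ x, κ s x y s' * (PS s * QX s x * P x y) :=
        Finset.sum_le_sum fun y _ => hg y
    _ = expectedLoss PS P κ QX QS := by
        simp only [expectedLoss, jointDist, ← sum_sum_comm (C := Y), Finset.mul_sum]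
        refine Finset.sum_congr rfl fun y _ => Finset.sum_congr rfl fun s' _ =>
          Finset.sum_congr rfl fun s _ => Finset.sum_congr rfl fun x _ => ?_
        ring

theorem optSCDet_eq_optSC : optSCDet PS P κ = optSC PS P κ := by
  classical
  refine le_antisymm (le_iInf₂ fun QX hQX => le_iInf₂ fun QS hQS => ?_) (le_iInf₂ fun f g => ?_)
  · obtain ⟨f, g, hfg⟩ := exists_codeLoss_le_expectedLoss (PS := PS) (P := P) (κ := κ) hQX hQS
    exact iInf₂_le_of_le f g (EReal.coe_le_coe_iff.2 hfg)
  · rw [← expectedLoss_single]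
    exact iInf₂_le_of_le _ (single_mem_condDist f) (iInf₂_le _ (single_mem_condDist g))

end Codes

section StrongDuality

variable {S X Y S' : Type*}

/-- The relaxation point with variables `(QX, QS, W)`, where `W` is curried from a kernel from
`S × Y` to `X × S'`; unlike `PrimalPoint`, the source is a topological vector space. -/
def toPrimalPoint (v : (S → X → ℝ) × (Y → S' → ℝ) × (S × Y → X × S' → ℝ)) :
    PrimalPoint S X Y S' :=
  ⟨v.1, v.2.1, fun s x y s' => v.2.2 (s, y) (x, s')⟩

variable [Fintype X] [Fintype S']

/-- The triples `(QX, QS, W)` of kernels, with the coupling constraints of LP' dropped. -/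
def relaxedCodes (S X Y S' : Type*) [Fintype X] [Fintype S'] :
    Set ((S → X → ℝ) × (Y → S' → ℝ) × (S × Y → X × S' → ℝ)) :=
  condDist S X ×ˢ condDist Y S' ×ˢ condDist (S × Y) (X × S')

theorem convex_relaxedCodes : Convex ℝ (relaxedCodes S X Y S') :=
  convex_condDist.prod (convex_condDist.prod convex_condDist)

theorem isCompact_relaxedCodes : IsCompact (relaxedCodes S X Y S') :=
  isCompact_condDist.prod (isCompact_condDist.prod isCompact_condDist)

/-- The violation of the coupling constraints of LP': the decoder and encoder kernels minus the
marginals of `W`. -/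
def marginalDefect (S X Y S' : Type*) [Fintype X] [Fintype S'] :
    (S → X → ℝ) × (Y → S' → ℝ) × (S × Y → X × S' → ℝ) →ₗ[ℝ] (S × Y × S') ⊕ (S × Y × X) → ℝ where
  toFun v := Sum.elim
    (fun ⟨s, y, s'⟩ => v.2.1 y s' - ∑ x, v.2.2 (s, y) (x, s'))
    (fun ⟨s, y, x⟩ => v.1 s x - ∑ s', v.2.2 (s, y) (x, s'))
  map_add' v w := by
    ext (_ | _) <;> simp [Finset.sum_add_distrib] <;> ring
  map_smul' c v := by
    ext (_ | _) <;> simp [← Finset.mul_sum, mul_sub]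

theorem feaLP'_eq_image :
    feaLP' S X Y S' =
      toPrimalPoint '' {v ∈ relaxedCodes S X Y S' | marginalDefect S X Y S' v = 0} := by
  ext v
  refine ⟨fun hv => ?_, ?_⟩
  · obtain ⟨hQX, hQS, hWS, hWX, hW⟩ := mem_feaLP'_iff.1 hv
    refine ⟨(v.QX, v.QS, fun i j => v.W i.1 j.1 i.2 j.2),
      ⟨⟨hQX, hQS, fun ⟨s, y⟩ => ⟨?_, ?_⟩⟩, ?_⟩, rfl⟩
    · exact fun ⟨x, s'⟩ => hW s x y s'
    · simp [Fintype.sum_prod_type, hWX, (hQX s).2]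
    · ext (⟨s, y, s'⟩ | ⟨s, y, x⟩) <;> simp [marginalDefect, hWS, hWX]
  · rintro ⟨v, ⟨⟨hQX, hQS, hW⟩, hv⟩, rfl⟩
    refine mem_feaLP'_iff.2 ⟨hQX, hQS, fun s y s' => ?_, fun s x y => ?_,
      fun s x y s' => (hW (s, y)).1 (x, s')⟩
    · exact (sub_eq_zero.1 (congrFun hv (Sum.inl (s, y, s')))).symm
    · exact (sub_eq_zero.1 (congrFun hv (Sum.inr (s, y, x)))).symm

variable [Fintype S] [Fintype Y]

/-- The objective function of LP' as a linear functional. -/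
def objLinear (PS : S → ℝ) (P : X → Y → ℝ) (κ : S → X → Y → S' → ℝ) :
    (S → X → ℝ) × (Y → S' → ℝ) × (S × Y → X × S' → ℝ) →ₗ[ℝ] ℝ where
  toFun v := objLP' PS P κ (toPrimalPoint v)
  map_add' v w := by
    simp [objLP', toPrimalPoint, mul_add, Finset.sum_add_distrib]
  map_smul' c v := by
    simp only [objLP', toPrimalPoint, Finset.mul_sum, Prod.smul_snd, Pi.smul_apply, smul_eq_mul,
      RingHom.id_apply, mul_left_comm c]

variable (PS : S → ℝ) (P : X → Y → ℝ) (κ : S → X → Y → S' → ℝ)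

theorem exists_isMinOn_feaLP' [Nonempty X] [Nonempty S'] :
    ∃ v ∈ feaLP' S X Y S', IsMinOn (objLP' PS P κ) (feaLP' S X Y S') v := by
  classical
  have hne : (feaLP' S X Y S').Nonempty :=
    ⟨_, productPoint_mem_feaLP' (single_mem_condDist fun _ => Classical.arbitrary X)
      (single_mem_condDist fun _ => Classical.arbitrary S')⟩
  rw [feaLP'_eq_image, Set.image_nonempty] at hne
  obtain ⟨v, hv, hmin⟩ := (isCompact_relaxedCodes.inter_right (isClosed_singleton.preimage
    (marginalDefect S X Y S').continuous_of_finiteDimensional)).exists_isMinOn hne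
    (objLinear PS P κ).continuous_of_finiteDimensional.continuousOn
  rw [feaLP'_eq_image]
  exact ⟨_, Set.mem_image_of_mem _ hv, isMinOn_iff.2 (Set.forall_mem_image.2 (isMinOn_iff.1 hmin))⟩

theorem optLP'_le_coe_iff [Nonempty X] [Nonempty S'] {r : ℝ} :
    optLP' PS P κ ≤ r ↔ ∃ v ∈ feaLP' S X Y S', objLP' PS P κ v ≤ r := by
  refine ⟨fun h => ?_, fun ⟨v, hv, hvr⟩ => iInf₂_le_of_le v hv (EReal.coe_le_coe_iff.2 hvr)⟩
  obtain ⟨v, hv, hmin⟩ := exists_isMinOn_feaLP' PS P κ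
  refine ⟨v, hv, EReal.coe_le_coe_iff.1 (le_trans (le_iInf₂ fun w hw => ?_) h)⟩
  exact EReal.coe_le_coe_iff.2 (hmin hw)

theorem lagrangian_single [DecidableEq X] [DecidableEq S'] (l : (S × Y × S') ⊕ (S × Y × X) → ℝ)
    (f : S → X) (g : Y → S') (h : S × Y → X × S') :
    objLinear PS P κ (fun s => Pi.single (f s) 1, fun y => Pi.single (g y) 1,
        fun i => Pi.single (h i) 1) +
      l ⬝ᵥ marginalDefect S X Y S' (fun s => Pi.single (f s) 1, fun y => Pi.single (g y) 1,
        fun i => Pi.single (h i) 1) =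
      ∑ s, ∑ y, l (.inr (s, y, f s)) + ∑ y, ∑ s, l (.inl (s, y, g y)) +
        ∑ s, ∑ y, (κ s (h (s, y)).1 y (h (s, y)).2 * PS s * P (h (s, y)).1 y -
          l (.inl (s, y, (h (s, y)).2)) - l (.inr (s, y, (h (s, y)).1))) := by
  have hobj : objLinear PS P κ (fun s => Pi.single (f s) 1, fun y => Pi.single (g y) 1,
      fun i => Pi.single (h i) 1) =
      ∑ s, ∑ y, κ s (h (s, y)).1 y (h (s, y)).2 * PS s * P (h (s, y)).1 y := by
    refine Finset.sum_congr rfl fun s _ => Finset.sum_comm.trans ?_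
    simp [toPrimalPoint, Pi.single_apply, Prod.ext_iff, ite_and]
  have hdefect : l ⬝ᵥ marginalDefect S X Y S' (fun s => Pi.single (f s) 1,
      fun y => Pi.single (g y) 1, fun i => Pi.single (h i) 1) =
      ∑ s, ∑ y, (l (.inl (s, y, g y)) - l (.inl (s, y, (h (s, y)).2))) +
        ∑ s, ∑ y, (l (.inr (s, y, f s)) - l (.inr (s, y, (h (s, y)).1))) := by
    simp [marginalDefect, dotProduct, Fintype.sum_prod_type, Pi.single_apply,
      Prod.ext_iff, ite_and, mul_sub]
  rw [hobj, hdefect, Finset.sum_comm (γ := Y)]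
  simp only [Finset.sum_sub_distrib]
  ring

/-- By `lagrangian_single`, the right-hand side is the Lagrangian of LP' with multipliers `la` and
`lb` at the deterministic point `(f, g, h)`, here chosen to minimize it. -/
theorem exists_mem_feaDP'_objDP_eq [Nonempty X] [Nonempty S'] (la : S → S' → Y → ℝ)
    (lb : X → S → Y → ℝ) :
    ∃ (f : S → X) (g : Y → S') (h : S × Y → X × S'), ∃ d ∈ feaDP' PS P κ,
      objDP d = ∑ s, ∑ y, lb (f s) s y + ∑ y, ∑ s, la s (g y) y +
        ∑ s, ∑ y, (κ s (h (s, y)).1 y (h (s, y)).2 * PS s * P (h (s, y)).1 y -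
          la s (h (s, y)).2 y - lb (h (s, y)).1 s y) := by
  choose f hf using fun s => Finite.exists_min fun x => ∑ y, lb x s y
  choose g hg using fun y => Finite.exists_min fun s' => ∑ s, la s s' y
  choose h hh using fun i : S × Y => Finite.exists_min fun j : X × S' =>
    κ i.1 j.1 i.2 j.2 * PS i.1 * P j.1 i.2 - la i.1 j.2 i.2 - lb j.1 i.1 i.2
  let m (s : S) (y : Y) : ℝ := κ s (h (s, y)).1 y (h (s, y)).2 * PS s * P (h (s, y)).1 y -
    la s (h (s, y)).2 y - lb (h (s, y)).1 s y
  refine ⟨f, g, h, ⟨fun s => ∑ y, (lb (f s) s y + m s y), fun y => ∑ s, la s (g y) y, la,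
    fun x s y => lb x s y + m s y, 0⟩,
    ⟨⟨fun x s => ?_, fun s' y => ?_, fun s x y s' => ?_, ?_⟩, ?_⟩, ?_⟩
  · simpa [Finset.sum_add_distrib] using hf s x
  · simpa using hg y s'
  · have := hh (s, y) (x, s')
    simp only [Pi.zero_apply]
    linarith
  · simp
  · simp
  · simp only [objDP, Pi.zero_apply, Finset.sum_const_zero, Finset.sum_add_distrib, sub_zero, m]
    ring

theorem optLP'_le_optDP' [Nonempty X] [Nonempty S'] : optLP' PS P κ ≤ optDP' PS P κ := by
  classical
  refine EReal.ge_of_forall_gt_iff_ge.1 fun r hr => ?_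
  have hfeas : ∀ v ∈ relaxedCodes S X Y S', marginalDefect S X Y S' v = 0 →
      r < objLinear PS P κ v := fun v hv hv0 => by
    have hmem : toPrimalPoint v ∈ feaLP' S X Y S' := by
      rw [feaLP'_eq_image]
      exact Set.mem_image_of_mem _ ⟨hv, hv0⟩
    exact EReal.coe_lt_coe_iff.1 (hr.trans_le (iInf₂_le _ hmem))
  obtain ⟨l, hl⟩ := exists_lagrange_multiplier isCompact_relaxedCodes convex_relaxedCodes
    (objLinear PS P κ).toContinuousLinearMap (marginalDefect S X Y S').toContinuousLinearMap hfeas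
  obtain ⟨f, g, h, d, hd, hobj⟩ := exists_mem_feaDP'_objDP_eq PS P κ
    (fun s s' y => l (.inl (s, y, s'))) (fun x s y => l (.inr (s, y, x)))
  refine le_iSup₂_of_le d hd (EReal.coe_le_coe_iff.2 ?_)
  rw [hobj, ← lagrangian_single]
  exact (hl _ ⟨single_mem_condDist f, single_mem_condDist g, single_mem_condDist h⟩).le

theorem optLP'_eq_optDP' [Nonempty X] [Nonempty S'] : optLP' PS P κ = optDP' PS P κ :=
  (optLP'_le_optDP' PS P κ).antisymm optDP'_le_optLP'

end StrongDuality

section NonSignaling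

variable {X Y : Type*} [Fintype X] {M : ℕ}

theorem feaNS_eq_feaLP' [Nonempty Y] (hM : 1 ≤ M) :
    feaNS X Y M = feaLP' (Fin M) X Y (Fin M) := by
  ext v
  have hQX (hW : ∀ x s y, ∑ s', v.W s x y s' - v.QX s x = 0) (s : Fin M) (y : Y) :
      ∑ x, ∑ s', v.W s x y s' = ∑ x, v.QX s x :=
    Finset.sum_congr rfl fun x _ => sub_eq_zero.1 (hW x s y)
  have hQS (hW : ∀ s s' y, ∑ x, v.W s x y s' - v.QS y s' = 0) (s : Fin M) (y : Y) :
      ∑ x, ∑ s', v.W s x y s' = ∑ s', v.QS y s' :=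
    Finset.sum_comm.trans (Finset.sum_congr rfl fun s' _ => sub_eq_zero.1 (hW s s' y))
  constructor
  · rintro ⟨hWS, hWX, hW1, hnonneg⟩
    exact ⟨fun s => (hQX hWX s (Classical.arbitrary Y)).symm.trans (hW1 s _),
      fun y => (hQS hWS ⟨0, hM⟩ y).symm.trans (hW1 _ y), hWS, hWX, hnonneg⟩
  · rintro ⟨hX, -, hWS, hWX, hnonneg⟩
    exact ⟨hWS, hWX, fun s y => (hQX hWX s y).trans (hX s), hnonneg⟩

theorem sum_errLoss_mul {X Y : Type*} (s : Fin M) (x : X) (y : Y) (a : Fin M → ℝ) :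
    ∑ s', errLoss X Y M s x y s' * a s' = ∑ s', a s' - a s := by
  simp [errLoss, ite_not, Finset.sum_ite, Finset.filter_ne, Finset.sum_erase_eq_sub]

variable [Fintype Y] {P : X → Y → ℝ}

theorem objNS_eq_objLP' (hP : P ∈ condDist X Y) (hM : 1 ≤ M)
    {v : PrimalPoint (Fin M) X Y (Fin M)} (hv : v ∈ feaLP' (Fin M) X Y (Fin M)) :
    objNS P M v = objLP' (unif M) P (errLoss X Y M) v := by
  obtain ⟨hQX, -, -, hWX, -⟩ := mem_feaLP'_iff.1 hv
  have hloss (s : Fin M) (x : X) (y : Y) :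
      ∑ s', errLoss X Y M s x y s' * unif M s * P x y * v.W s x y s' =
        1 / (M : ℝ) * (v.QX s x * P x y - P x y * v.W s x y s) := by
    simp only [mul_assoc, sum_errLoss_mul, ← Finset.mul_sum, hWX, unif]
    ring
  have htotal : ∑ s, ∑ x, v.QX s x * ∑ y, P x y = M := by
    simp [(hP _).2, (hQX _).2]
  have hM0 : (M : ℝ) ≠ 0 := by positivity
  simp only [objNS, objLP', hloss, ← Finset.mul_sum, Finset.sum_sub_distrib, htotal, mul_sub,
    one_div_mul_cancel hM0]

theorem optNS_eq_optLP' [Nonempty Y] (hP : P ∈ condDist X Y) (hM : 1 ≤ M) :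
    optNS P M = optLP' (unif M) P (errLoss X Y M) := by
  rw [optNS, optLP', feaNS_eq_feaLP' hM]
  exact biInf_congr fun v hv => by rw [objNS_eq_objLP' hP hM hv]

end NonSignaling

section ScaledTests

variable {X Y : Type*} [Fintype X] [Fintype Y] {P : X → Y → ℝ} {α t : ℝ}

/-- The pairs `(P_X, R)` with `R = P_X T` for a test `T` of power at least `α` under
`P_{XY} = P_X P`. The constraints are jointly linear in `(P_X, R)`, but not in `(P_X, T)`. -/
def scaledTests (α : ℝ) (P : X → Y → ℝ) : Set ((X → ℝ) × (X → Y → ℝ)) :=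
  {v | v.1 ∈ stdSimplex ℝ X ∧ (∀ x y, v.2 x y ∈ Set.Icc 0 (v.1 x)) ∧
    α ≤ ∑ x, ∑ y, P x y * v.2 x y}

theorem mul_mem_scaledTests {p : X → ℝ} (hp : p ∈ stdSimplex ℝ X) {T : X × Y → ℝ}
    (hT : T ∈ tests α fun r : X × Y => P r.1 r.2 * p r.1) :
    (p, fun x y => p x * T (x, y)) ∈ scaledTests α P := by
  refine ⟨hp, fun x y => ⟨mul_nonneg (hp.1 x) (hT.1 _).1,
    mul_le_of_le_one_right (hp.1 x) (hT.1 _).2⟩, hT.2.trans_eq ?_⟩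
  rw [Fintype.sum_prod_type]
  exact Finset.sum_congr rfl fun x _ => Finset.sum_congr rfl fun y _ => by ring

theorem exists_test_of_mem_scaledTests {v : (X → ℝ) × (X → Y → ℝ)} (hv : v ∈ scaledTests α P) :
    ∃ T ∈ tests α (fun r : X × Y => P r.1 r.2 * v.1 r.1), ∀ x y, T (x, y) * v.1 x = v.2 x y := by
  obtain ⟨hp, hR, hpow⟩ := hv
  have hmul (x : X) (y : Y) : v.2 x y / v.1 x * v.1 x = v.2 x y :=
    div_mul_cancel_of_imp fun h0 => le_antisymm (h0 ▸ (hR x y).2) (hR x y).1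
  refine ⟨fun r => v.2 r.1 r.2 / v.1 r.1, ⟨fun r => ⟨?_, ?_⟩, ?_⟩, hmul⟩
  · exact div_nonneg (hR _ _).1 (hp.1 _)
  · exact div_le_one_of_le₀ (hR _ _).2 (hp.1 _)
  · simpa only [Fintype.sum_prod_type, mul_left_comm _ (P _ _), hmul] using hpow

theorem scaledTests_nonempty [Nonempty X] (hP : P ∈ condDist X Y) (hα : α ≤ 1) :
    (scaledTests α P).Nonempty := by
  classical
  have hp := single_mem_stdSimplex ℝ (Classical.arbitrary X)
  refine ⟨_, mul_mem_scaledTests (T := 1) hp ⟨fun _ => ⟨zero_le_one, le_rfl⟩, ?_⟩⟩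
  simpa only [Pi.one_apply, one_mul, Fintype.sum_prod_type, ← Finset.sum_mul, (hP _).2, hp.2]

theorem convex_scaledTests : Convex ℝ (scaledTests α P) := by
  rintro v ⟨hv, hvR, hvα⟩ w ⟨hw, hwR, hwα⟩ a b ha hb hab
  refine ⟨convex_stdSimplex ℝ X hv hw ha hb hab, fun x y => ⟨?_, ?_⟩, ?_⟩
  · exact add_nonneg (mul_nonneg ha (hvR x y).1) (mul_nonneg hb (hwR x y).1)
  · exact add_le_add (mul_le_mul_of_nonneg_left (hvR x y).2 ha)
      (mul_le_mul_of_nonneg_left (hwR x y).2 hb)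
  · simp only [Prod.snd_add, Prod.smul_snd, Pi.add_apply, Pi.smul_apply, smul_eq_mul, mul_add,
      mul_left_comm (P _ _), Finset.sum_add_distrib, ← Finset.mul_sum]
    linear_combination a * hvα + b * hwα - α * hab

theorem isCompact_scaledTests : IsCompact (scaledTests α P) := by
  have hcompact : IsCompact (stdSimplex ℝ X ×ˢ Set.Icc (0 : X → Y → ℝ) 1) :=
    (isCompact_stdSimplex ℝ X).prod isCompact_Icc
  refine hcompact.of_isClosed_subset ?_ fun v ⟨hp, hR, _⟩ =>
    ⟨hp, fun x y => (hR x y).1, fun x y =>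
      (hR x y).2.trans (mem_Icc_of_mem_stdSimplex hp x).2⟩
  simp only [scaledTests, Set.mem_Icc, Set.ofPred_and, Set.ofPred_forall]
  refine ((isClosed_stdSimplex ℝ X).preimage continuous_fst).inter (.inter
    (isClosed_iInter fun x => isClosed_iInter fun y => .inter ?_ ?_) ?_)
  all_goals exact isClosed_le (by fun_prop) (by fun_prop)

end ScaledTests

section TestGame

variable {X Y : Type*} [Fintype X] [Fintype Y] {P : X → Y → ℝ} {α t : ℝ}

/-- `t` is the value of the zero-sum game with payoff `∑ y, Q_Y(y) ∑ x, R(x, y)`, the type II error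
under `P_X × Q_Y`, in which one player minimizes over the pairs `(P_X, R)` in `scaledTests α P` and
the other maximizes over `Q_Y`. The value is certified by a saddle point; against a fixed
`(P_X, R)` it is enough to test the point masses `Q_Y`. -/
def IsTestGameValue (α : ℝ) (P : X → Y → ℝ) (t : ℝ) : Prop :=
  (∃ v ∈ scaledTests α P, ∀ y, ∑ x, v.2 x y ≤ t) ∧
    ∃ q ∈ stdSimplex ℝ Y, ∀ w ∈ scaledTests α P, t ≤ ∑ y, q y * ∑ x, w.2 x y

theorem exists_isTestGameValue [Nonempty X] (hP : P ∈ condDist X Y) (hα : α ≤ 1) :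
    ∃ t, IsTestGameValue α P t := by
  classical
  have := nonempty_of_mem_condDist hP
  have hne : (stdSimplex ℝ Y).Nonempty :=
    ⟨_, single_mem_stdSimplex ℝ (Classical.arbitrary Y)⟩
  obtain ⟨v, hv, q, hq, hsaddle⟩ := Sion.exists_isSaddlePointOn (E := (X → ℝ) × (X → Y → ℝ))
    (F := Y → ℝ)
    (f := fun v q => ∑ y, q y * ∑ x, v.2 x y)
    (scaledTests_nonempty hP hα) convex_scaledTests isCompact_scaledTests
    (fun q _ => ContinuousOn.lowerSemicontinuousOn (by fun_prop))
    (fun q _ => ConvexOn.quasiconvexOn ⟨convex_scaledTests, fun v _ w _ a b _ _ _ => le_of_eq <| by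
      simp only [Prod.snd_add, Prod.smul_snd, Pi.add_apply, Pi.smul_apply, smul_eq_mul,
        Finset.sum_add_distrib, ← Finset.mul_sum, mul_add, mul_left_comm (q _)]⟩)
    (convex_stdSimplex ℝ Y) hne (isCompact_stdSimplex ℝ Y)
    (fun v _ => ContinuousOn.upperSemicontinuousOn (by fun_prop))
    (fun v _ => ConcaveOn.quasiconcaveOn ⟨convex_stdSimplex ℝ Y, fun q _ k _ a b _ _ _ =>
      le_of_eq <| by
        simp only [Pi.add_apply, Pi.smul_apply, smul_eq_mul, add_mul, mul_assoc,
          Finset.sum_add_distrib, ← Finset.mul_sum]⟩)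
  refine ⟨∑ y, q y * ∑ x, v.2 x y, ⟨v, hv, fun y => ?_⟩, q, hq, fun w hw => hsaddle w hw q hq⟩
  simpa [Pi.single_apply] using hsaddle v hv _ (single_mem_stdSimplex ℝ y)

theorem IsTestGameValue.pos (hP : P ∈ condDist X Y) (hα : 0 < α) (h : IsTestGameValue α P t) :
    0 < t := by
  obtain ⟨v, ⟨-, hR, hpow⟩, hlev⟩ := h.1
  by_contra! ht
  have hR0 (x : X) (y : Y) : v.2 x y ≤ 0 :=
    (Finset.single_le_sum (fun x _ => (hR x y).1) (Finset.mem_univ x)).trans ((hlev y).trans ht)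
  have hsum : ∑ x, ∑ y, P x y * v.2 x y ≤ 0 :=
    Finset.sum_nonpos fun x _ => Finset.sum_nonpos fun y _ =>
      mul_nonpos_of_nonneg_of_nonpos ((hP x).1 y) (hR0 x y)
  linarith

theorem IsTestGameValue.le_of_forall_sum_le (h : IsTestGameValue α P t)
    {v : (X → ℝ) × (X → Y → ℝ)} (hv : v ∈ scaledTests α P) {u : ℝ}
    (hu : ∀ y, ∑ x, v.2 x y ≤ u) : t ≤ u := by
  obtain ⟨q, hq, hqt⟩ := h.2
  exact (hqt v hv).trans (sum_mul_le_of_mem_stdSimplex hq hu)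

theorem sum_mul_prod_mul (T : X × Y → ℝ) (p : X → ℝ) (q : Y → ℝ) :
    ∑ r, T r * (p r.1 * q r.2) = ∑ y, q y * ∑ x, p x * T (x, y) := by
  simp only [Fintype.sum_prod_type_right, Finset.mul_sum]
  exact Finset.sum_congr rfl fun y _ => Finset.sum_congr rfl fun x _ => by ring

theorem IsTestGameValue.exists_forall_ofReal_le_beta (h : IsTestGameValue α P t) :
    ∃ q ∈ stdSimplex ℝ Y, ∀ p ∈ stdSimplex ℝ X, ENNReal.ofReal t ≤
      beta α (fun r : X × Y => P r.1 r.2 * p r.1) fun r : X × Y => p r.1 * q r.2 := by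
  obtain ⟨q, hq, hqt⟩ := h.2
  refine ⟨q, hq, fun p hp => le_iInf₂ fun T hT => ENNReal.ofReal_le_ofReal ?_⟩
  rw [sum_mul_prod_mul]
  exact hqt _ (mul_mem_scaledTests hp hT)

theorem IsTestGameValue.exists_forall_beta_le_ofReal (h : IsTestGameValue α P t) :
    ∃ p ∈ stdSimplex ℝ X, ∀ q ∈ stdSimplex ℝ Y,
      beta α (fun r : X × Y => P r.1 r.2 * p r.1) (fun r : X × Y => p r.1 * q r.2) ≤
        ENNReal.ofReal t := by
  obtain ⟨v, hv, hvt⟩ := h.1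
  obtain ⟨T, hT, hTv⟩ := exists_test_of_mem_scaledTests hv
  refine ⟨v.1, hv.1, fun q hq => iInf₂_le_of_le T hT (ENNReal.ofReal_le_ofReal ?_)⟩
  rw [sum_mul_prod_mul]
  refine sum_mul_le_of_mem_stdSimplex hq fun y => ?_
  simpa only [mul_comm (v.1 _), hTv] using hvt y

theorem boundPPV_eq_ofReal_inv {ε : ℝ} (h : IsTestGameValue (1 - ε) P t) (ht : 0 < t) :
    boundPPV P ε = ENNReal.ofReal t⁻¹ := by
  rw [ENNReal.ofReal_inv_of_pos ht]
  apply le_antisymm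
  · obtain ⟨q, hq, hle⟩ := h.exists_forall_ofReal_le_beta
    exact iSup₂_le fun p hp => iInf₂_le_of_le q hq (ENNReal.inv_le_inv.2 (hle p hp))
  · obtain ⟨p, hp, hle⟩ := h.exists_forall_beta_le_ofReal
    exact le_iSup₂_of_le p hp (le_iInf₂ fun q hq => ENNReal.inv_le_inv.2 (hle q hq))

theorem exists_mem_Icc_sum_eq {A : Type*} [Fintype A] {f g : A → ℝ} (hfg : f ≤ g) {u : ℝ}
    (hf : ∑ a, f a ≤ u) (hg : u ≤ ∑ a, g a) : ∃ h ∈ Set.Icc f g, ∑ a, h a = u :=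
  (convex_Icc f g).isPreconnected.intermediate_value (Set.left_mem_Icc.2 hfg)
    (Set.right_mem_Icc.2 hfg) (f := fun h => ∑ a, h a) (by fun_prop) ⟨hf, hg⟩

theorem IsTestGameValue.exists_sum_eq (hP : P ∈ condDist X Y) (h : IsTestGameValue α P t)
    {u : ℝ} (htu : t ≤ u) (hu : u ≤ 1) :
    ∃ w ∈ scaledTests α P, ∀ y, ∑ x, w.2 x y = u := by
  obtain ⟨⟨p, R⟩, ⟨hp, hR, hpow⟩, hlev⟩ := h.1
  choose R' hR' hsum using fun y => exists_mem_Icc_sum_eq (fun x => (hR x y).2)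
    ((hlev y).trans htu) (hu.trans_eq hp.2.symm)
  refine ⟨(p, fun x y => R' y x), ⟨hp, fun x y => ⟨?_, (hR' y).2 x⟩, hpow.trans ?_⟩, hsum⟩
  · exact (hR x y).1.trans ((hR' y).1 x)
  · exact Finset.sum_le_sum fun x _ => Finset.sum_le_sum fun y _ =>
      mul_le_mul_of_nonneg_left ((hR' y).1 x) ((hP x).1 y)

end TestGame

section Symmetrization

variable {X Y : Type*} [Fintype X] {M : ℕ}

/-- The point of the program LP' attached to `(p, R)` that is invariant under permutations of the
messages: every message has encoder `p`, the decoder is uniform, and a message is decoded correctly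
with weight `R`, the remaining weight `p - R` being shared equally by the `M - 1` other messages.
For `M = 1` no other message exists and the quotient by `0` is never used. -/
def symmetricPoint (M : ℕ) (p : X → ℝ) (R : X → Y → ℝ) : PrimalPoint (Fin M) X Y (Fin M) where
  QX _ := p
  QS _ := unif M
  W s x y s' := if s' = s then R x y else (p x - R x y) / (M - 1)

theorem sum_ite_eq_add_mul (s : Fin M) (a b : ℝ) :
    ∑ s', (if s' = s then a else b) = a + (M - 1) * b := by
  have hM : 1 ≤ M := s.pos
  rw [Finset.sum_ite, Finset.filter_eq', if_pos (Finset.mem_univ s), Finset.sum_singleton,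
    Finset.filter_ne', Finset.sum_const, Finset.card_erase_of_mem (Finset.mem_univ s)]
  simp [hM]

theorem symmetricPoint_mem_feaLP' (hM : 1 ≤ M) {p : X → ℝ} {R : X → Y → ℝ}
    (hp : p ∈ stdSimplex ℝ X) (hR : ∀ x y, R x y ∈ Set.Icc 0 (p x))
    (hsum : ∀ y, ∑ x, R x y = 1 / (M : ℝ)) :
    symmetricPoint M p R ∈ feaLP' (Fin M) X Y (Fin M) := by
  have hM1 : (1 : ℝ) ≤ M := mod_cast hM
  refine mem_feaLP'_iff.2 ⟨fun _ => hp, fun _ => ⟨fun _ => ?_, ?_⟩, fun s y s' => ?_,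
    fun s x y => ?_, fun s x y s' => ?_⟩
  · simp [symmetricPoint, unif]
  · have hM0 : (M : ℝ) ≠ 0 := by positivity
    simp [symmetricPoint, unif, hM0]
  · dsimp only [symmetricPoint, unif]
    split_ifs with hs
    · exact hsum y
    · have hM2 : (M : ℝ) - 1 ≠ 0 := by
        have : Nontrivial (Fin M) := ⟨s', s, hs⟩
        have : 1 < M := Fin.nontrivial_iff_two_le.1 this
        exact sub_ne_zero.2 (by exact_mod_cast this.ne')
      rw [← Finset.sum_div, Finset.sum_sub_distrib, hp.2, hsum]
      field_simp
  · dsimp only [symmetricPoint]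
    have hRp (h : (M : ℝ) - 1 = 0) : p x - R x y = 0 := by
      refine sub_eq_zero.2 ((Finset.sum_eq_sum_iff_of_le fun x _ => (hR x y).2).1 ?_ x
        (Finset.mem_univ x)).symm
      rw [hsum, hp.2, sub_eq_zero.1 h, div_one]
    rw [sum_ite_eq_add_mul, mul_div_cancel_of_imp' hRp, add_sub_cancel]
  · dsimp only [symmetricPoint]
    split_ifs
    · exact (hR x y).1
    · exact div_nonneg (sub_nonneg.2 (hR x y).2) (sub_nonneg.2 hM1)

variable [Fintype Y] {P : X → Y → ℝ} {α : ℝ}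

theorem objNS_symmetricPoint (hM : 1 ≤ M) (p : X → ℝ) (R : X → Y → ℝ) :
    objNS P M (symmetricPoint M p R) = 1 - ∑ x, ∑ y, P x y * R x y := by
  have hM0 : (M : ℝ) ≠ 0 := by positivity
  simp [objNS, symmetricPoint, hM0]

theorem exists_mem_scaledTests_of_mem_feaLP' (hM : 1 ≤ M)
    {v : PrimalPoint (Fin M) X Y (Fin M)} (hv : v ∈ feaLP' (Fin M) X Y (Fin M))
    (hobj : objNS P M v ≤ 1 - α) :
    ∃ w ∈ scaledTests α P, ∀ y, ∑ x, w.2 x y = 1 / (M : ℝ) := by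
  obtain ⟨hQX, hQS, hWS, hWX, hW⟩ := mem_feaLP'_iff.1 hv
  have hM0 : (M : ℝ) ≠ 0 := by positivity
  refine ⟨(fun x => 1 / (M : ℝ) * ∑ s, v.QX s x, fun x y => 1 / (M : ℝ) * ∑ s, v.W s x y s),
    ⟨⟨fun x => ?_, ?_⟩, fun x y => ⟨?_, ?_⟩, ?_⟩, fun y => ?_⟩
  · exact mul_nonneg (by positivity) (Finset.sum_nonneg fun s _ => (hQX s).1 x)
  · rw [← Finset.mul_sum, Finset.sum_comm]
    simp [(hQX _).2, hM0]
  · exact mul_nonneg (by positivity) (Finset.sum_nonneg fun s _ => hW s x y s)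
  · refine mul_le_mul_of_nonneg_left (Finset.sum_le_sum fun s _ => ?_) (by positivity)
    rw [← hWX s x y]
    exact Finset.single_le_sum (fun s' _ => hW s x y s') (Finset.mem_univ s)
  · have hpow : ∑ x, ∑ y, P x y * (1 / (M : ℝ) * ∑ s, v.W s x y s) =
        1 / (M : ℝ) * ∑ s, ∑ x, ∑ y, P x y * v.W s x y s := by
      simp only [mul_left_comm (P _ _), ← Finset.mul_sum, Finset.sum_comm (γ := Fin M)]
    rw [hpow]
    rw [objNS] at hobj
    linarith
  · rw [← Finset.mul_sum, Finset.sum_comm]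
    simp only [hWS, (hQS y).2, mul_one]

theorem optLP'_le_iff_exists_mem_scaledTests [Nonempty X] (hP : P ∈ condDist X Y) (hM : 1 ≤ M)
    {ε : ℝ} :
    optLP' (unif M) P (errLoss X Y M) ≤ (ε : EReal) ↔
      ∃ w ∈ scaledTests (1 - ε) P, ∀ y, ∑ x, w.2 x y = 1 / (M : ℝ) := by
  have : Nonempty (Fin M) := ⟨⟨0, hM⟩⟩
  rw [optLP'_le_coe_iff]
  constructor
  · rintro ⟨v, hv, hobj⟩
    rw [← objNS_eq_objLP' hP hM hv] at hobj
    exact exists_mem_scaledTests_of_mem_feaLP' hM hv (hobj.trans_eq (sub_sub_cancel 1 ε).symm)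
  · rintro ⟨w, ⟨hp, hR, hpow⟩, hsum⟩
    have hv := symmetricPoint_mem_feaLP' hM hp hR hsum
    refine ⟨_, hv, ?_⟩
    rw [← objNS_eq_objLP' hP hM hv, objNS_symmetricPoint hM]
    exact sub_le_comm.1 hpow

end Symmetrization

section Converse

variable {X Y : Type*} [Fintype X] [Fintype Y] {P : X → Y → ℝ} {ε t : ℝ}

theorem mem_sizesDP'_iff [Nonempty X] (hP : P ∈ condDist X Y) (h : IsTestGameValue (1 - ε) P t)
    (ht : 0 < t) {M : ℕ} : M ∈ sizesDP' P ε ↔ 1 ≤ M ∧ (M : ℝ) ≤ t⁻¹ := by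
  refine and_congr_right fun hM => ?_
  have : Nonempty (Fin M) := ⟨⟨0, hM⟩⟩
  have hM1 : (1 : ℝ) ≤ M := mod_cast hM
  have hMpos : (0 : ℝ) < M := by positivity
  rw [← optLP'_eq_optDP', optLP'_le_iff_exists_mem_scaledTests hP hM, le_inv_comm₀ hMpos ht,
    ← one_div]
  constructor
  · rintro ⟨w, hw, hsum⟩
    exact h.le_of_forall_sum_le hw fun y => (hsum y).le
  · exact fun htM => h.exists_sum_eq hP htM ((div_le_one hMpos).2 hM1)

theorem achievableSizes_subset_sizesDP' (P : X → Y → ℝ) (ε : ℝ) :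
    achievableSizes P ε ⊆ sizesDP' P ε := by
  rintro M ⟨hM, f, g, hfg⟩
  have : Nonempty X := ⟨f ⟨0, hM⟩⟩
  have : Nonempty (Fin M) := ⟨⟨0, hM⟩⟩
  refine ⟨hM, optDP'_le_optDP.trans (optDP_le_optSC.trans ?_)⟩
  rw [← optSCDet_eq_optSC]
  exact iInf₂_le_of_le f g (EReal.coe_le_coe_iff.2 hfg)

theorem one_mem_achievableSizes {X : Type*} [Nonempty X] (P : X → Y → ℝ) (hε : 0 ≤ ε) :
    1 ∈ achievableSizes P ε := by
  refine ⟨le_rfl, fun _ => Classical.arbitrary X, fun _ => 0, ?_⟩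
  simpa [codeLoss, errLoss] using hε

theorem exists_boundPPV_eq_ofReal_inv [Nonempty X] (hP : P ∈ condDist X Y) (hε0 : 0 ≤ ε)
    (hε : ε < 1) :
    ∃ t, 0 < t ∧ IsTestGameValue (1 - ε) P t ∧ boundPPV P ε = ENNReal.ofReal t⁻¹ := by
  obtain ⟨t, h⟩ := exists_isTestGameValue hP (sub_le_self 1 hε0)
  have ht := h.pos hP (sub_pos.2 hε)
  exact ⟨t, ht, h, boundPPV_eq_ofReal_inv h ht⟩

theorem boundPPV_ne_top [Nonempty X] (hP : P ∈ condDist X Y) (hε0 : 0 ≤ ε) (hε : ε < 1) :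
    boundPPV P ε ≠ ⊤ := by
  obtain ⟨t, -, -, hPPV⟩ := exists_boundPPV_eq_ofReal_inv hP hε0 hε
  exact hPPV ▸ ENNReal.ofReal_ne_top

theorem isGreatest_sizesDP' [Nonempty X] (hP : P ∈ condDist X Y) (hε0 : 0 ≤ ε) (hε : ε < 1) :
    IsGreatest (sizesDP' P ε) ⌊(boundPPV P ε).toReal⌋₊ := by
  obtain ⟨t, ht, h, hPPV⟩ := exists_boundPPV_eq_ofReal_inv hP hε0 hε
  have hinv : 0 ≤ t⁻¹ := by positivity
  have hone : 1 ∈ sizesDP' P ε :=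
    achievableSizes_subset_sizesDP' P ε (one_mem_achievableSizes P hε0)
  rw [hPPV, ENNReal.toReal_ofReal hinv]
  refine ⟨(mem_sizesDP'_iff hP h ht).2 ⟨?_, Nat.floor_le hinv⟩, fun M hM => ?_⟩
  · exact Nat.le_floor ((mem_sizesDP'_iff hP h ht).1 hone).2
  · exact Nat.le_floor ((mem_sizesDP'_iff hP h ht).1 hM).2

theorem isGreatest_achievableSizes {X : Type*} [Finite X] [Nonempty X] {P : X → Y → ℝ}
    (hP : P ∈ condDist X Y) (hε0 : 0 ≤ ε) (hε : ε < 1) :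
    IsGreatest (achievableSizes P ε) (maxCodeSize P ε) :=
  have := Fintype.ofFinite X
  have hbdd : BddAbove (achievableSizes P ε) :=
    (isGreatest_sizesDP' hP hε0 hε).bddAbove.mono (achievableSizes_subset_sizesDP' P ε)
  ⟨Nat.sSup_mem ⟨1, one_mem_achievableSizes P hε0⟩ hbdd, fun _ hM => le_csSup hbdd hM⟩

end Converse

end SourceChannel

end

theorem mainTheorem9 {X Y : Type*} [Fintype X] [Fintype Y] [Nonempty X]
    (P : X → Y → ℝ) (hP : P ∈ SourceChannel.condDist X Y) :
    (∀ M : ℕ, 1 ≤ M →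
      -- NS and LP' are the same program
      SourceChannel.feaNS X Y M = SourceChannel.feaLP' (Fin M) X Y (Fin M) ∧
      (∀ v ∈ SourceChannel.feaLP' (Fin M) X Y (Fin M), SourceChannel.objNS P M v =
        SourceChannel.objLP' (SourceChannel.unif M) P (SourceChannel.errLoss X Y M) v) ∧
      SourceChannel.optNS P M =
        SourceChannel.optLP' (SourceChannel.unif M) P (SourceChannel.errLoss X Y M) ∧
      SourceChannel.optLP' (SourceChannel.unif M) P (SourceChannel.errLoss X Y M) =
        SourceChannel.optDP' (SourceChannel.unif M) P (SourceChannel.errLoss X Y M) ∧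
      -- the chain of lower bounds on the error probability of any code
      (∀ QX ∈ SourceChannel.condDist (Fin M) X, ∀ QS ∈ SourceChannel.condDist Y (Fin M),
        SourceChannel.optSC (SourceChannel.unif M) P (SourceChannel.errLoss X Y M) ≤
          (SourceChannel.expectedLoss (SourceChannel.unif M) P
            (SourceChannel.errLoss X Y M) QX QS : EReal)) ∧
      SourceChannel.optSCDet (SourceChannel.unif M) P (SourceChannel.errLoss X Y M) =
        SourceChannel.optSC (SourceChannel.unif M) P (SourceChannel.errLoss X Y M) ∧
      SourceChannel.optDP (SourceChannel.unif M) P (SourceChannel.errLoss X Y M) ≤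
        SourceChannel.optSC (SourceChannel.unif M) P (SourceChannel.errLoss X Y M) ∧
      SourceChannel.optDP' (SourceChannel.unif M) P (SourceChannel.errLoss X Y M) ≤
        SourceChannel.optDP (SourceChannel.unif M) P (SourceChannel.errLoss X Y M)) ∧
    (∀ ε : ℝ, 0 ≤ ε → ε < 1 →
      -- both maxima exist, and the PPV bound is finite
      IsGreatest (SourceChannel.achievableSizes P ε) (SourceChannel.maxCodeSize P ε) ∧
      IsGreatest (SourceChannel.sizesDP' P ε) (SourceChannel.maxSizeDP' P ε) ∧
      SourceChannel.boundPPV P ε ≠ ⊤ ∧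
      SourceChannel.maxCodeSize P ε ≤ SourceChannel.maxSizeDP' P ε ∧
      SourceChannel.maxSizeDP' P ε = ⌊(SourceChannel.boundPPV P ε).toReal⌋₊) := by
  have := SourceChannel.nonempty_of_mem_condDist hP
  refine ⟨fun M hM => ?_, fun ε hε0 hε => ?_⟩
  · have : Nonempty (Fin M) := ⟨⟨0, hM⟩⟩
    exact ⟨SourceChannel.feaNS_eq_feaLP' hM,
      fun _ hv => SourceChannel.objNS_eq_objLP' hP hM hv,
      SourceChannel.optNS_eq_optLP' hP hM,
      SourceChannel.optLP'_eq_optDP' _ _ _,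
      fun QX hQX QS hQS => iInf₂_le_of_le QX hQX (iInf₂_le QS hQS),
      SourceChannel.optSCDet_eq_optSC,
      SourceChannel.optDP_le_optSC,
      SourceChannel.optDP'_le_optDP⟩
  · have hcode := SourceChannel.isGreatest_achievableSizes hP hε0 hε
    have hDP := SourceChannel.isGreatest_sizesDP' hP hε0 hε
    have hfloor : SourceChannel.maxSizeDP' P ε = ⌊(SourceChannel.boundPPV P ε).toReal⌋₊ :=
      hDP.csSup_eq
    rw [← hfloor] at hDP
    exact ⟨hcode, hDP, SourceChannel.boundPPV_ne_top hP hε0 hε,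
      hDP.2 (SourceChannel.achievableSizes_subset_sizesDP' P ε hcode.1), hfloor⟩
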